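/- Let $A$ be an arbitrary commutative ring (not assumed Noetherian, possibly zero), let $n\ge 0$, and let $r_0,\dots,r_n,r_{n+1}$ be natural numbers with $r_{n+1}=0$. Let $$L_\bullet:\quad 0\to L_n\xrightarrow{u_n}L_{n-1}\xrightarrow{u_{n-1}}\cdots\xrightarrow{u_2}L_1\xrightarrow{u_1}L_0$$ be a complex of free $A$-modules ($u_\ell\circ u_{\ell+1}=0$) with $L_k\cong A^{r_{k+1}+r_k}$ for $0\le k\le n$. Notation. For a matrix (or a linear map between finite free modules, through its matrix in given bases) $u$, let $\mathcal D_k(u)$ be the ideal generated by the minors of order $k$ of $u$ (so $\mathcal D_0(u)=\langle 1\rangle$), and put $\mathfrak D_\ell=\mathcal D_{r_\ell}(u_\ell)$ for $1\le\ell\le n$. The map $u$ is called *stable of stable rank $r$* if $\mathcal D_r(u)$ is faithful (its annihilator is $0$) and $\mathcal D_{r+1}(u)=0$. For a finitely generated ideal $\mathfrak a$ of $A$ and $k\ge 0$, a *Kronecker sequence* of length $k$ attached to $\mathfrak a$ is a sequence $f_1,\dots,f_k$ of polynomials over $A$, in pairwise disjoint sets of variables, such that the coefficients of each $f_i$ generate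 $\mathfrak a$; one writes $\mathrm{Gr}(\mathfrak a)\ge k$ (true grade) if such a sequence is regular in the polynomial ring $A[\underline X]$, i.e. each $f_i$ is a non-zero-divisor modulo $\langle f_1,\dots,f_{i-1}\rangle$ (the quotient by the whole sequence may be zero); this does not depend on the chosen sequence. In particular $\mathrm{Gr}(\mathfrak a)\ge 0$ always holds. Theorem. The complex $L_\bullet$ is exact (at $L_1,\dots,L_n$, which for $n\ge1$ includes injectivity of $u_n$; nothing is required at $L_0$) if and only if $\mathrm{Gr}(\mathfrak D_\ell)\ge\ell$ for every $1\le\ell\le n$. Moreover, if $L_\bullet$ is exact, then each $u_\ell$ ($1\le\ell\le n$) is stable of stable rank $r_\ell$. -/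

import Mathlib

namespace FreeComplexExactness

/-- The content ideal of a polynomial in several variables: the ideal generated by its
coefficients. -/
def contentIdeal {A : Type*} [CommRing A] (f : MvPolynomial ℕ A) : Ideal A :=
  Ideal.span (Set.range fun m : ℕ →₀ ℕ => MvPolynomial.coeff m f)

/-- `f 0, …, f (k - 1)` is a Kronecker sequence of length `k` attached to the ideal `I`:
every `f i` has content `I`, and the `f i` involve pairwise disjoint sets of variables. -/
def IsKroneckerSeq {A : Type*} [CommRing A] (I : Ideal A) {k : ℕ}
    (f : Fin k → MvPolynomial ℕ A) : Prop :=
  (∀ i, contentIdeal (f i) = I) ∧ Pairwise fun i j => Disjoint (f i).vars (f j).vars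

/-- `Gr(I) ≥ k` (true grade, Hochster–Northcott depth) for a finitely generated ideal `I`:
a Kronecker sequence of length `k` attached to `I` is a regular sequence in the polynomial ring.
As in the theory of true grade, `IsWeaklyRegular` asks only that each term be a non-zero-divisor
modulo the preceding ones (the quotient by all the terms may be zero). For `k = 0` the condition
always holds. -/
def TrueGradeGE {A : Type*} [CommRing A] (I : Ideal A) (k : ℕ) : Prop :=
  ∃ f : Fin k → MvPolynomial ℕ A, IsKroneckerSeq I f ∧
    RingTheory.Sequence.IsWeaklyRegular (MvPolynomial ℕ A) (List.ofFn f)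

/-- The determinantal ideal `𝒟_k(M)`, generated by the minors of order `k` of `M`. Choices of
rows or columns with a repetition only add the generator `0`, and reordering them only changes the
sign. In particular `𝒟_0(M) = ⟨1⟩`, and `𝒟_k(M) = 0` if `k` exceeds the number of rows or the
number of columns. -/
def detIdeal {A : Type*} [CommRing A] {m n : Type*} (M : Matrix m n A) (k : ℕ) : Ideal A :=
  Ideal.span (Set.range fun rc : (Fin k → m) × (Fin k → n) => (M.submatrix rc.1 rc.2).det)

/-- An ideal is faithful if only `0` is annihilated by all its elements. -/
def IsFaithfulIdeal {A : Type*} [CommRing A] (I : Ideal A) : Prop :=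
  ∀ x : A, (∀ a ∈ I, a * x = 0) → x = 0

/-- A matrix is stable of stable rank `r` if `𝒟_r(M)` is faithful and `𝒟_{r+1}(M) = 0`. -/
def HasStableRank {A : Type*} [CommRing A] {m n : Type*} (M : Matrix m n A) (r : ℕ) : Prop :=
  IsFaithfulIdeal (detIdeal M r) ∧ detIdeal M (r + 1) = ⊥

end FreeComplexExactness

/-! Here `M k` is the matrix of u_{k+1}, so its ideal of minors of order `r (k + 1)`, written D(M k)
below, should have grade at least k + 1.

The local fact: if v has an invertible minor of order r and no nonzero minor of order r + 1, then
coker v is free of the complementary rank s, and every w with w v = 0 factors through it. Exactness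
of (v, w) then says that the factor is injective, which by McCoy and Cramer means that D_s(w) is
faithful. Localising at the minors of v and descending from the end of the complex, where the
modules vanish, exactness yields the stable ranks (`hasStableRank_of_exact`).

From exactness to grade: D(M k) is faithful, so the univariate polynomial f whose coefficients
generate it is a non-zero-divisor. Modulo f the complex loses exactness only at its last place, so
the truncated complex over A[T]/f is exact, and induction supplies the rest of the Kronecker
sequence (`isWeaklyRegular_kroneckerPoly_of_exact`).

From grade to exactness: over A[X] the extended ideals contain genuine regular sequences, and
constant coefficients bring exactness back to A. By induction on the length, only exactness at L_1
is in question (`matExact_zero_of_hasWeaklyRegularSeq`). A homology class there is killed by a power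
of D(M 1). If it is killed by a power of D(M (j+1)), then wherever a maximal minor of M (j+2) is
invertible the cokernel of M (j+2) is free, and the acyclicity lemma
`mem_range_of_forall_smul_mem_range` makes the class vanish; hence a power of D(M (j+2)) kills it.
Past the end of the complex the ideal is the unit ideal, so the class is zero. -/

open Matrix

namespace FreeComplexExactness

/-! ### Minors, faithful ideals, McCoy's theorem and rank factorisations. -/

section DeterminantalIdeals

variable {R : Type*} [CommRing R] {m n p q κ : Type*}

/-- `N` maps onto the kernel of `M`. -/
def MatExact [Fintype m] [Fintype p] (N : Matrix m p R) (M : Matrix q m R) : Prop :=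
  ∀ x : m → R, M *ᵥ x = 0 → ∃ y : p → R, N *ᵥ y = x

theorem det_submatrix_mem_detIdeal (M : Matrix m n R) {k : ℕ} (ρ : Fin k → m) (γ : Fin k → n) :
    (M.submatrix ρ γ).det ∈ detIdeal M k :=
  Ideal.subset_span ⟨(ρ, γ), rfl⟩

theorem detIdeal_zero (M : Matrix m n R) : detIdeal M 0 = ⊤ := by
  rw [Ideal.eq_top_iff_one]
  have h := det_submatrix_mem_detIdeal M (k := 0) Fin.elim0 Fin.elim0
  rwa [det_isEmpty] at h

theorem detIdeal_eq_bot_iff (M : Matrix m n R) (k : ℕ) :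
    detIdeal M k = ⊥ ↔ ∀ (ρ : Fin k → m) (γ : Fin k → n), (M.submatrix ρ γ).det = 0 := by
  rw [detIdeal, Ideal.span_eq_bot]
  exact ⟨fun h ρ γ => h _ ⟨(ρ, γ), rfl⟩, by rintro h _ ⟨⟨ρ, γ⟩, rfl⟩; exact h ρ γ⟩

theorem detIdeal_submatrix_le (M : Matrix m n R) (f : p → m) (g : q → n) (k : ℕ) :
    detIdeal (M.submatrix f g) k ≤ detIdeal M k := by
  rw [detIdeal, Ideal.span_le]
  rintro _ ⟨⟨ρ, γ⟩, rfl⟩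
  exact det_submatrix_mem_detIdeal M (f ∘ ρ) (g ∘ γ)

theorem detIdeal_map {S : Type*} [CommRing S] (φ : R →+* S) (M : Matrix m n R) (k : ℕ) :
    detIdeal (M.map φ) k = (detIdeal M k).map φ := by
  rw [detIdeal, detIdeal, Ideal.map_span, ← Set.range_comp]
  congr 2
  funext rc
  simp only [Function.comp_apply, RingHom.map_det, RingHom.mapMatrix_apply, submatrix_map]

theorem IsFaithfulIdeal.mono {I J : Ideal R} (h : IsFaithfulIdeal I) (hIJ : I ≤ J) :
    IsFaithfulIdeal J :=
  fun x hx => h x fun a ha => hx a (hIJ ha)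

theorem isFaithfulIdeal_top : IsFaithfulIdeal (⊤ : Ideal R) :=
  fun x hx => by simpa using hx 1 trivial

theorem IsFaithfulIdeal.pow {I : Ideal R} (h : IsFaithfulIdeal I) (k : ℕ) :
    IsFaithfulIdeal (I ^ k) := by
  induction k with
  | zero => simpa using isFaithfulIdeal_top
  | succ k ih =>
    intro x hx
    refine h x fun a ha => ih _ fun c hc => ?_
    rw [← mul_assoc]
    exact hx _ (by rw [pow_succ]; exact Ideal.mul_mem_mul hc ha)

/-- The minors of order `k` of `M` act on the kernel of `M` as `0`, if `M` has `k` columns. -/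
theorem mul_eq_zero_of_mem_detIdeal [Fintype κ] {k : ℕ} (hκ : Fintype.card κ = k)
    (M : Matrix q κ R) (y : κ → R) (hy : M *ᵥ y = 0) (a : R) (ha : a ∈ detIdeal M k) (i : κ) :
    a * y i = 0 := by
  classical
  induction ha using Submodule.span_induction with
  | mem a ha =>
    obtain ⟨⟨ρ, γ⟩, rfl⟩ := ha
    by_cases hγ : Function.Injective γ
    · have hb : Function.Bijective γ :=
        (Fintype.bijective_iff_injective_and_card γ).2 ⟨hγ, by simp [hκ]⟩
      let e := Equiv.ofBijective γ hb
      have h0 : M.submatrix ρ γ *ᵥ (y ∘ γ) = 0 := by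
        have := submatrix_mulVec_equiv M (y ∘ γ) ρ e
        have h2 : (y ∘ γ) ∘ e.symm = y := by
          funext j
          exact congrArg y (e.apply_symm_apply j)
        rw [h2, hy] at this
        exact this
      have h1 := congrArg (fun z => (M.submatrix ρ γ).adjugate *ᵥ z) h0
      simp only [mulVec_mulVec, adjugate_mul, mulVec_zero, smul_mulVec, one_mulVec] at h1
      obtain ⟨j, rfl⟩ := hb.2 i
      simpa using congrFun h1 j
    · rw [Function.Injective] at hγ
      push Not at hγ
      obtain ⟨j, l, hjl, hne⟩ := hγ
      have : (M.submatrix ρ γ).det = 0 :=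
        det_zero_of_column_eq hne fun i => by simp [hjl]
      simp [this]
  | zero => simp
  | add a b _ _ ha hb => rw [add_mul, ha, hb, add_zero]
  | smul c a _ ha => rw [smul_eq_mul, mul_assoc, ha, mul_zero]

/-- McCoy's theorem for matrices. -/
theorem isFaithfulIdeal_detIdeal_of_injective [Fintype κ] {s : ℕ} (hκ : Fintype.card κ = s)
    (M : Matrix q κ R) (hM : ∀ y, M *ᵥ y = 0 → y = 0) : IsFaithfulIdeal (detIdeal M s) := by
  classical
  suffices H : ∀ k ≤ s, IsFaithfulIdeal (detIdeal M k) from H s le_rfl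
  intro k
  induction k with
  | zero => intro _; rw [detIdeal_zero]; exact isFaithfulIdeal_top
  | succ k ih =>
    intro hk x hx
    refine ih (by omega) x fun a ha => ?_
    induction ha using Submodule.span_induction with
    | mem a ha =>
      obtain ⟨⟨ρ, γ⟩, rfl⟩ := ha
      obtain ⟨c, hc⟩ : ∃ c, c ∉ Set.range γ := by
        by_contra! h
        have := Fintype.card_le_of_surjective γ h
        simp [hκ] at this
        omega
      let γ' : Fin (k + 1) → κ := Fin.cons c γ
      -- Signed cofactors along an extra row, scaled by x: coordinate i of `M *ᵥ y` is x times the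
      -- minor with row i added, which vanishes, while coordinate c of `y` is x times the given
      -- minor.
      let y : κ → R := ∑ j, Pi.single (γ' j)
        ((-1) ^ (j : ℕ) * (M.submatrix ρ (γ' ∘ j.succAbove)).det * x)
      have hy : M *ᵥ y = 0 := by
        funext i
        have h1 : (M.submatrix (Fin.cons i ρ : Fin (k + 1) → q) γ').det * x = 0 :=
          hx _ (det_submatrix_mem_detIdeal M _ _)
        rw [det_succ_row_zero, Finset.sum_mul] at h1
        rw [mulVec_sum, Finset.sum_apply, Pi.zero_apply, ← h1]
        refine Finset.sum_congr rfl fun j _ => ?_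
        rw [mulVec_single]
        simp only [submatrix_apply, Fin.cons_zero, submatrix_submatrix, Pi.smul_apply,
          col_apply, op_smul_eq_smul, smul_eq_mul]
        have : (Fin.cons i ρ : Fin (k + 1) → q) ∘ Fin.succ = ρ := by
          funext l; simp
        rw [this]
        ring
      have h2 := congrFun (hM y hy) c
      simp only [y] at h2
      rw [Finset.sum_apply, Fin.sum_univ_succ] at h2
      have h3 : γ' ∘ Fin.succAbove 0 = γ := by
        funext l; simp [γ']
      rw [h3, Finset.sum_eq_zero, add_zero] at h2
      · simpa [γ'] using h2
      · intro j _
        have : c ≠ γ' j.succ := by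
          simp only [γ', Fin.cons_succ]
          exact fun h => hc ⟨j, h.symm⟩
        exact Pi.single_eq_of_ne this _
    | zero => simp
    | add a b _ _ ha hb => rw [add_mul, ha, hb, add_zero]
    | smul c a _ ha => rw [smul_eq_mul, mul_assoc, ha, mul_zero]

/-- Padding the left factor to a square matrix creates a zero column. -/
theorem det_mul_eq_zero_of_card_lt [Fintype κ] {s : ℕ} (hκ : Fintype.card κ < s)
    (P : Matrix (Fin s) κ R) (Q : Matrix κ (Fin s) R) : (P * Q).det = 0 := by
  classical
  let e := Fintype.equivFin κ
  let f : κ → Fin s := fun i => Fin.castLE hκ.le (e i)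
  have hf : Function.Injective f := (Fin.castLE_injective _).comp e.injective
  let E : Matrix κ (Fin s) R := (1 : Matrix (Fin s) (Fin s) R).submatrix f id
  have hE : E * Eᵀ = 1 := by
    ext i j
    simp [E, mul_apply, one_apply, hf.eq_iff, eq_comm]
  have h1 : P * Q = (P * E) * (Eᵀ * Q) := by
    rw [Matrix.mul_assoc, ← Matrix.mul_assoc E, hE, Matrix.one_mul]
  rw [h1, det_mul, det_eq_zero_of_column_eq_zero (⟨_, hκ⟩ : Fin s), zero_mul]
  intro i
  simp only [mul_apply, E, submatrix_apply, id, one_apply]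
  refine Finset.sum_eq_zero fun j _ => ?_
  rw [if_neg, mul_zero]
  intro h
  have := congrArg Fin.val h
  simp [f] at this
  have := (e j).2
  omega

theorem detIdeal_mul_eq_bot [Fintype κ] {s : ℕ} (hκ : Fintype.card κ < s)
    (P : Matrix m κ R) (Q : Matrix κ n R) : detIdeal (P * Q) s = ⊥ := by
  rw [detIdeal_eq_bot_iff]
  intro ρ γ
  rw [submatrix_mul P Q ρ id γ Function.bijective_id]
  exact det_mul_eq_zero_of_card_lt hκ _ _

theorem detIdeal_mul_le [Fintype κ] {s : ℕ} (hκ : Fintype.card κ = s)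
    (P : Matrix m κ R) (Q : Matrix κ n R) : detIdeal (P * Q) s ≤ detIdeal P s := by
  rw [detIdeal, Ideal.span_le]
  rintro _ ⟨⟨ρ, γ⟩, rfl⟩
  let e : Fin s ≃ κ := (Fintype.equivFinOfCardEq hκ).symm
  dsimp only
  rw [submatrix_mul P Q ρ e γ e.bijective, det_mul]
  exact Ideal.mul_mem_right _ _ (det_submatrix_mem_detIdeal P ρ e)

theorem eq_mul_of_detIdeal_eq_bot {r : ℕ} {v : Matrix m p R} {ρ : Fin r → m}
    {γ : Fin r → p} (h : IsUnit (v.submatrix ρ γ).det)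
    (hv : detIdeal v (r + 1) = ⊥) :
    v = v.submatrix id γ * ((v.submatrix ρ γ)⁻¹ * v.submatrix ρ id) := by
  ext i j
  rw [detIdeal_eq_bot_iff] at hv
  -- The invertible minor bordered by row i and column j: its determinant is a unit times a 1 × 1
  -- Schur complement, which is therefore zero.
  have h1 := hv (Sum.elim ρ (fun _ => i) ∘ finSumFinEquiv.symm)
    (Sum.elim γ (fun _ => j) ∘ finSumFinEquiv.symm)
  rw [← submatrix_submatrix, det_submatrix_equiv_self] at h1
  have h2 : v.submatrix (Sum.elim ρ (fun _ : Fin 1 => i)) (Sum.elim γ (fun _ : Fin 1 => j)) =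
      fromBlocks (v.submatrix ρ γ) (v.submatrix ρ fun _ => j) (v.submatrix (fun _ => i) γ)
        (v.submatrix (fun _ => i) fun _ => j) := by
    ext (a | a) (b | b) <;> rfl
  let _ := invertibleOfIsUnitDet _ h
  rw [h2, det_fromBlocks₁₁, h.mul_right_eq_zero, det_fin_one, Matrix.sub_apply, sub_eq_zero,
    invOf_eq_nonsing_inv, Matrix.mul_assoc] at h1
  exact h1

end DeterminantalIdeals

/-! ### The cokernel of a matrix with an invertible minor. -/

section UnitMinor

variable {R : Type*} [CommRing R] {m p q : Type*} [Fintype m] [DecidableEq m] {r s : ℕ}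

/-- The projector parallel to the columns `γ` of `v`, onto the coordinate subspace where the
coordinates `ρ` vanish. -/
noncomputable def columnProjector (v : Matrix m p R) (ρ : Fin r → m) (γ : Fin r → p) : Matrix m m R :=
  1 - v.submatrix id γ * ((v.submatrix ρ γ)⁻¹ * (1 : Matrix m m R).submatrix ρ id)

/-- The restriction of `columnProjector` to the coordinates outside `ρ`. -/
noncomputable def columnCoproj (v : Matrix m p R) (ρ : Fin r → m) (γ : Fin r → p) :
    Matrix {i // i ∉ Set.range ρ} m R :=
  (columnProjector v ρ γ).submatrix Subtype.val id

variable {v : Matrix m p R} {ρ : Fin r → m} {γ : Fin r → p}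

theorem card_compl_range [Nontrivial R] (h : IsUnit (v.submatrix ρ γ).det)
    (hm : Fintype.card m = r + s) [Fintype {i // i ∉ Set.range ρ}] :
    Fintype.card {i // i ∉ Set.range ρ} = s := by
  have hρ : Function.Injective ρ := by
    intro i j hij
    by_contra hne
    refine h.ne_zero (det_zero_of_row_eq hne ?_)
    funext l
    simp [hij]
  have h1 := Fintype.card_subtype_compl (fun i => i ∈ Set.range ρ)
  have h2 : Fintype.card {i // i ∈ Set.range ρ} = r :=
    (Fintype.card_congr (Equiv.ofInjective ρ hρ).symm).trans (Fintype.card_fin r)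
  rw [Fintype.card_congr (Equiv.refl _), h1, h2]
  omega

theorem columnProjector_mulVec (x : m → R) : columnProjector v ρ γ *ᵥ x =
    x - v.submatrix id γ *ᵥ ((v.submatrix ρ γ)⁻¹ *ᵥ (x ∘ ρ)) := by
  have : (1 : Matrix m m R).submatrix ρ id *ᵥ x = x ∘ ρ := by
    funext i
    simp [mulVec, dotProduct, one_apply]
  rw [columnProjector, sub_mulVec, one_mulVec, ← mulVec_mulVec, ← mulVec_mulVec, this]

theorem columnCoproj_mulVec (x : m → R) :
    columnCoproj v ρ γ *ᵥ x = (columnProjector v ρ γ *ᵥ x) ∘ Subtype.val := rfl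

theorem columnProjector_mulVec_apply (h : IsUnit (v.submatrix ρ γ).det) (x : m → R) (i : Fin r) :
    (columnProjector v ρ γ *ᵥ x) (ρ i) = 0 := by
  have h1 : (v.submatrix id γ *ᵥ ((v.submatrix ρ γ)⁻¹ *ᵥ (x ∘ ρ))) (ρ i) =
      (v.submatrix ρ γ *ᵥ ((v.submatrix ρ γ)⁻¹ *ᵥ (x ∘ ρ))) i := rfl
  rw [columnProjector_mulVec, Pi.sub_apply, h1, mulVec_mulVec, mul_nonsing_inv _ h, one_mulVec]
  simp

/-- The projector already vanishes on the coordinates `ρ`, so here it kills x entirely, and x is a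
combination of the columns `γ`. -/
theorem exists_mulVec_of_columnCoproj_mulVec_eq_zero [Fintype p]
    (h : IsUnit (v.submatrix ρ γ).det) (x : m → R) (hx : columnCoproj v ρ γ *ᵥ x = 0) :
    ∃ y, v *ᵥ y = x := by
  classical
  have h0 : columnProjector v ρ γ *ᵥ x = 0 := by
    funext i
    by_cases hi : i ∈ Set.range ρ
    · obtain ⟨j, rfl⟩ := hi
      exact columnProjector_mulVec_apply h x j
    · exact congrFun hx ⟨i, hi⟩
  rw [columnProjector_mulVec, sub_eq_zero] at h0
  refine ⟨(1 : Matrix p p R).submatrix id γ *ᵥ ((v.submatrix ρ γ)⁻¹ *ᵥ (x ∘ ρ)), ?_⟩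
  rw [mulVec_mulVec]
  have h1 : v * (1 : Matrix p p R).submatrix id γ = v.submatrix id γ := by
    ext i j
    simp [mul_apply, one_apply]
  rw [h1, ← h0]

theorem columnCoproj_mul (h : IsUnit (v.submatrix ρ γ).det) (hv : detIdeal v (r + 1) = ⊥) :
    columnCoproj v ρ γ * v = 0 := by
  have h1 : columnProjector v ρ γ * v = 0 := by
    have h2 : (1 : Matrix m m R).submatrix ρ id * v = v.submatrix ρ id := by
      ext i j
      simp [mul_apply, one_apply]
    rw [columnProjector, Matrix.sub_mul, Matrix.one_mul, Matrix.mul_assoc, Matrix.mul_assoc, h2,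
      ← eq_mul_of_detIdeal_eq_bot h hv, sub_self]
  ext i j
  exact congrFun (congrFun h1 i) j

theorem columnCoproj_mulVec_extend (y : {i // i ∉ Set.range ρ} → R) :
    columnCoproj v ρ γ *ᵥ (Function.extend Subtype.val y 0) = y := by
  have h1 : Function.extend Subtype.val y 0 ∘ ρ = 0 := by
    funext i
    rw [Function.comp_apply, Function.extend_apply']
    · rfl
    · rintro ⟨a, ha⟩
      exact a.2 ⟨i, ha.symm⟩
  rw [columnCoproj_mulVec, columnProjector_mulVec, h1, mulVec_zero, mulVec_zero, sub_zero]
  exact Function.extend_comp Subtype.val_injective _ _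

/-- The projector differs from the identity by combinations of columns of v, which w kills; since
its rows in `ρ` are zero, only the complementary coordinates contribute. -/
theorem eq_mul_columnCoproj [Fintype p] [Fintype {i // i ∉ Set.range ρ}]
    (h : IsUnit (v.submatrix ρ γ).det)
    (w : Matrix q m R) (hwv : w * v = 0) :
    w = (w.submatrix id Subtype.val : Matrix q {i // i ∉ Set.range ρ} R) *
      columnCoproj v ρ γ := by
  have h1 : w * columnProjector v ρ γ = w := by
    have : w * v.submatrix id γ = 0 := by
      ext i j
      exact congrFun (congrFun hwv i) (γ j)
    rw [columnProjector, Matrix.mul_sub, Matrix.mul_one, ← Matrix.mul_assoc, this, Matrix.zero_mul,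
      sub_zero]
  ext i j
  conv_lhs => rw [← h1]
  simp only [mul_apply, columnCoproj]
  have h2 : ∀ a ∈ Set.range ρ, columnProjector v ρ γ a j = 0 := by
    rintro _ ⟨a, rfl⟩
    have := columnProjector_mulVec_apply h (Pi.single j 1) a
    simpa using this
  refine (Fintype.sum_of_injective Subtype.val Subtype.val_injective _
    (fun a => w i a * columnProjector v ρ γ a j) (fun a ha => ?_) fun a => rfl).symm
  rw [h2, mul_zero]
  by_contra h
  exact ha ⟨⟨a, h⟩, rfl⟩

theorem detIdeal_succ_eq_bot_of_isUnit [Fintype p] (h : IsUnit (v.submatrix ρ γ).det)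
    (hm : Fintype.card m = r + s) (w : Matrix q m R) (hwv : w * v = 0) :
    detIdeal w (s + 1) = ⊥ := by
  classical
  nontriviality R
  rw [eq_mul_columnCoproj h w hwv]
  exact detIdeal_mul_eq_bot (by rw [card_compl_range h hm]; omega) _ _

theorem isFaithfulIdeal_of_isUnit [Fintype p] (h : IsUnit (v.submatrix ρ γ).det)
    (hm : Fintype.card m = r + s) (hv : detIdeal v (r + 1) = ⊥)
    (w : Matrix q m R) (hwv : w * v = 0) (hex : MatExact v w) :
    IsFaithfulIdeal (detIdeal w s) := by
  classical
  rcases subsingleton_or_nontrivial R with _ | _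
  · exact fun x _ => Subsingleton.elim _ _
  refine (isFaithfulIdeal_detIdeal_of_injective (card_compl_range h hm)
    (w.submatrix id Subtype.val) fun y hy => ?_).mono (detIdeal_submatrix_le w _ _ _)
  have h1 : w *ᵥ (Function.extend Subtype.val y 0) = 0 := by
    rw [eq_mul_columnCoproj h w hwv, ← mulVec_mulVec, columnCoproj_mulVec_extend, hy]
  obtain ⟨z, hz⟩ := hex _ h1
  rw [← columnCoproj_mulVec_extend (v := v) (ρ := ρ) (γ := γ) y, ← hz, mulVec_mulVec,
    columnCoproj_mul h hv, zero_mulVec]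

theorem matExact_of_isUnit [Fintype p] (h : IsUnit (v.submatrix ρ γ).det)
    (hm : Fintype.card m = r + s) (w : Matrix q m R) (hwv : w * v = 0)
    (hw : IsFaithfulIdeal (detIdeal w s)) : MatExact v w := by
  classical
  intro x hx
  rcases subsingleton_or_nontrivial R with _ | _
  · exact ⟨0, funext fun _ => Subsingleton.elim _ _⟩
  refine exists_mulVec_of_columnCoproj_mulVec_eq_zero h x (funext fun i => hw _ fun a ha => ?_)
  rw [eq_mul_columnCoproj h w hwv] at ha hx
  rw [← mulVec_mulVec] at hx
  have hc := card_compl_range h hm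
  exact mul_eq_zero_of_mem_detIdeal hc _ _ hx a (detIdeal_mul_le hc _ _ ha) i

end UnitMinor

/-! ### Flat base change and clearing of denominators. -/

section BaseChange

variable {R : Type*} [CommRing R] {m n p q : Type*} [Fintype m] [Fintype p]

theorem piScalarRight_lTensor_mulVecLin (S : Type*) [CommRing S] [Algebra R S] [DecidableEq m]
    [DecidableEq q] [Fintype q]
    (M : Matrix q m R) (t : TensorProduct R S (m → R)) :
    TensorProduct.piScalarRight R S S q (M.mulVecLin.lTensor S t) =
      M.map (algebraMap R S) *ᵥ TensorProduct.piScalarRight R S S m t := by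
  induction t with
  | zero => simp
  | add a b ha hb => simp only [map_add, mulVec_add, ha, hb]
  | tmul s x =>
    funext i
    simp only [LinearMap.lTensor_tmul, TensorProduct.piScalarRight_apply,
      TensorProduct.piScalarRightHom_tmul, mulVecLin_apply, mulVec, dotProduct, map_apply, Algebra.smul_def, map_sum, map_mul,
      Finset.sum_mul, mul_assoc]

theorem MatExact.map_of_flat (S : Type*) [CommRing S] [Algebra R S] [Module.Flat R S] [Fintype q]
    {N : Matrix m p R} {M : Matrix q m R} (hMN : M * N = 0) (h : MatExact N M) :
    MatExact (N.map (algebraMap R S)) (M.map (algebraMap R S)) := by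
  classical
  have hex : Function.Exact N.mulVecLin M.mulVecLin := by
    intro x
    refine ⟨fun hx => h x hx, ?_⟩
    rintro ⟨y, rfl⟩
    simp [mulVec_mulVec, hMN]
  have hS := Module.Flat.lTensor_exact S hex
  intro x hx
  obtain ⟨t, rfl⟩ := (TensorProduct.piScalarRight R S S m).surjective x
  rw [← piScalarRight_lTensor_mulVecLin, LinearEquiv.map_eq_zero_iff] at hx
  obtain ⟨z, rfl⟩ := (hS t).1 hx
  exact ⟨_, (piScalarRight_lTensor_mulVecLin S N z).symm⟩

theorem detIdeal_fg [Finite n] [Finite q] (M : Matrix q n R) (k : ℕ) : (detIdeal M k).FG :=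
  Submodule.fg_span (Set.finite_range _)

theorem IsFaithfulIdeal.map_of_flat (S : Type*) [CommRing S] [Algebra R S] [Module.Flat R S]
    {I : Ideal R} (hfg : I.FG) (h : IsFaithfulIdeal I) :
    IsFaithfulIdeal (I.map (algebraMap R S)) := by
  obtain ⟨s, rfl⟩ := hfg
  -- The kernel of the column of generators is the annihilator of the ideal, so faithfulness becomes
  -- an exactness statement.
  let M : Matrix s Unit R := Matrix.of fun a _ => (a : R)
  have h1 : MatExact (0 : Matrix Unit Empty R) M := by
    intro x hx
    refine ⟨0, ?_⟩
    rw [mulVec_zero]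
    funext i
    refine (h (x i) fun a ha => ?_).symm
    induction ha using Submodule.span_induction with
    | mem a ha => simpa [M, mulVec, dotProduct] using congrFun hx ⟨a, ha⟩
    | zero => simp
    | add a b _ _ ha hb => rw [add_mul, ha, hb, add_zero]
    | smul c a _ ha => rw [smul_eq_mul, mul_assoc, ha, mul_zero]
  have h2 := h1.map_of_flat S (Matrix.mul_zero M)
  intro x hx
  obtain ⟨y, hy⟩ := h2 (fun _ => x) (by
    funext a
    simpa [M, mulVec, dotProduct] using
      hx (algebraMap R S a) (Ideal.mem_map_of_mem _ (Ideal.subset_span a.2)))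
  simpa [mulVec, dotProduct] using (congrFun hy ()).symm

theorem exists_detIdeal_pow_le [Finite n] [Finite q] (M : Matrix q n R) (k : ℕ) (J : Ideal R)
    (h : ∀ ρ γ, (M.submatrix ρ γ : Matrix (Fin k) (Fin k) R).det ∈ J.radical) :
    ∃ K, detIdeal M k ^ K ≤ J := by
  refine Ideal.exists_pow_le_of_le_radical_of_fg ?_ (detIdeal_fg M k)
  rw [detIdeal, Ideal.span_le]
  rintro _ ⟨⟨ρ, γ⟩, rfl⟩
  exact h ρ γ

/-- Each minor has a power killing x, hence so does the ideal of minors, and powers of a faithful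
ideal are faithful. -/
theorem eq_zero_of_forall_away [Finite n] [Finite q] {M : Matrix q n R} {k : ℕ}
    (hM : IsFaithfulIdeal (detIdeal M k)) (x : R)
    (hx : ∀ ρ γ, algebraMap R
      (Localization.Away (M.submatrix ρ γ : Matrix (Fin k) (Fin k) R).det) x = 0) : x = 0 := by
  obtain ⟨K, hK⟩ := exists_detIdeal_pow_le M k (Ideal.span {x}).annihilator fun ρ γ => by
    obtain ⟨⟨_, N, rfl⟩, hc⟩ := (IsLocalization.map_eq_zero_iff
      (Submonoid.powers (M.submatrix ρ γ).det) _ x).1 (hx ρ γ)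
    exact ⟨N, by simpa [Submodule.mem_annihilator_span_singleton] using hc⟩
  refine hM.pow K x fun a ha => ?_
  simpa [Submodule.mem_annihilator_span_singleton] using hK ha

theorem exists_pow_smul_eq_mulVec (v : Matrix m p R) (δ : R) (x : m → R)
    (y : p → Localization.Away δ)
    (hy : v.map (algebraMap R (Localization.Away δ)) *ᵥ y = algebraMap R _ ∘ x) :
    ∃ N : ℕ, ∃ z, v *ᵥ z = δ ^ N • x := by
  obtain ⟨⟨b, B, hB⟩, hb⟩ := IsLocalization.exist_integer_multiples_of_finite
    (Submonoid.powers δ) y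
  choose y' hy' using hb
  have h1 : ∀ i, algebraMap R (Localization.Away δ) ((v *ᵥ y' - b • x) i) = 0 := by
    intro i
    have h2 := congrFun hy i
    simp only [mulVec, dotProduct, map_apply, Function.comp_apply] at h2
    simp only [Pi.sub_apply, Pi.smul_apply, mulVec, dotProduct, map_sub, map_sum, map_mul,
      smul_eq_mul, hy', ← h2, Finset.mul_sum]
    rw [sub_eq_zero]
    refine Finset.sum_congr rfl fun j _ => ?_
    simp only [Algebra.smul_def]
    ring
  have h3 := fun i => (IsLocalization.map_eq_zero_iff (Submonoid.powers δ) _ _).1 (h1 i)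
  choose c hc using h3
  obtain ⟨C, hC⟩ := (∏ i, c i).2
  -- `δ ^ B` clears the denominators of y; `δ ^ C` kills the discrepancies that are zero only after
  -- localisation.
  refine ⟨C + B, δ ^ C • y', ?_⟩
  rw [mulVec_smul, pow_add, mul_smul, ← sub_eq_zero, ← smul_sub]
  dsimp only at hC hB
  rw [hB, hC]
  funext i
  classical
  rw [Pi.smul_apply, ← Finset.prod_erase_mul Finset.univ _ (Finset.mem_univ i), Submonoid.coe_mul,
    smul_eq_mul, mul_assoc, hc i, mul_zero, Pi.zero_apply]

end BaseChange

/-! ### Stable ranks and local exactness of the complex. -/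

section Complex

variable {R : Type*} [CommRing R] {r : ℕ → ℕ}
  (M : ∀ k, Matrix (Fin (r (k + 1) + r k)) (Fin (r (k + 1 + 1) + r (k + 1))) R)

theorem map_complex {S : Type*} [CommRing S] (φ : R →+* S) (hM : ∀ k, M k * M (k + 1) = 0)
    (k : ℕ) : (M k).map φ * (M (k + 1)).map φ = 0 := by
  rw [← Matrix.map_mul, hM, Matrix.map_zero _ (map_zero φ)]

theorem isUnit_det_map_away {m n : Type*} (v : Matrix m n R) {k : ℕ} (ρ : Fin k → m)
    (γ : Fin k → n) : IsUnit ((v.map (algebraMap R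
      (Localization.Away (v.submatrix ρ γ).det))).submatrix ρ γ).det := by
  rw [submatrix_map, ← RingHom.mapMatrix_apply, ← RingHom.map_det]
  exact IsLocalization.Away.algebraMap_isUnit _

/-- In a complex whose differential `M (k + 1)` has rank at least the expected one, the
differential `M k` has rank at most the expected one. -/
theorem detIdeal_succ_eq_bot (hM : ∀ k, M k * M (k + 1) = 0) (k : ℕ)
    (hf : IsFaithfulIdeal (detIdeal (M (k + 1)) (r (k + 1 + 1)))) :
    detIdeal (M k) (r (k + 1) + 1) = ⊥ := by
  rw [detIdeal_eq_bot_iff]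
  intro ρ γ
  refine eq_zero_of_forall_away hf _ fun ρ' γ' => ?_
  have h1 := detIdeal_succ_eq_bot_of_isUnit (s := r (k + 1))
    (isUnit_det_map_away (M (k + 1)) ρ' γ') (by simp) _ (map_complex M _ hM k)
  rw [detIdeal_eq_bot_iff] at h1
  have := h1 ρ γ
  rwa [submatrix_map, ← RingHom.mapMatrix_apply, ← RingHom.map_det] at this

/-- Both halves are checked after inverting each maximal minor of `M (k + 1)`, where the cokernel is
free. -/
theorem HasStableRank.of_matExact (hM : ∀ k, M k * M (k + 1) = 0) (k : ℕ)
    (hex : MatExact (M (k + 1)) (M k)) (hs : HasStableRank (M (k + 1)) (r (k + 1 + 1))) :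
    HasStableRank (M k) (r (k + 1)) := by
  refine ⟨fun x hx => eq_zero_of_forall_away hs.1 _ fun ρ γ => ?_,
    detIdeal_succ_eq_bot M hM k hs.1⟩
  have : Module.Flat R (Localization.Away ((M (k + 1)).submatrix ρ γ).det) :=
    IsLocalization.flat _ (Submonoid.powers ((M (k + 1)).submatrix ρ γ).det)
  refine isFaithfulIdeal_of_isUnit (s := r (k + 1)) (isUnit_det_map_away (M (k + 1)) ρ γ)
    (by simp) ?_ ((M k).map (algebraMap R _)) (map_complex M _ hM k)
    (hex.map_of_flat _ (hM k)) _ fun a ha => ?_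
  · rw [detIdeal_map, hs.2, Ideal.map_bot]
  · rw [detIdeal_map] at ha
    induction ha using Submodule.span_induction with
    | mem a ha =>
      obtain ⟨a, ha, rfl⟩ := ha
      rw [← map_mul, hx a ha, map_zero]
    | zero => simp
    | add a b _ _ ha hb => rw [add_mul, ha, hb, add_zero]
    | smul c a _ ha => rw [smul_eq_mul, mul_assoc, ha, mul_zero]

theorem hasStableRank_of_eq_zero {n : ℕ} (hr : ∀ k, n < k → r k = 0) (k : ℕ) (hk : n ≤ k) :
    HasStableRank (M k) (r (k + 1)) := by
  -- The order of the minors is separated from `r (k + 1)`, which also occurs in the type of `M k`.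
  suffices ∀ s, s = 0 → HasStableRank (M k) s from this _ (hr _ (by omega))
  rintro _ rfl
  refine ⟨by rw [detIdeal_zero]; exact isFaithfulIdeal_top, ?_⟩
  rw [detIdeal_eq_bot_iff]
  intro _ γ
  have := (γ 0).2
  simp only [hr (k + 1) (by omega), hr (k + 1 + 1) (by omega)] at this
  omega

theorem hasStableRank_of_exact {n : ℕ} (hr : ∀ k, n < k → r k = 0)
    (hM : ∀ k, M k * M (k + 1) = 0) (hex : ∀ k, MatExact (M (k + 1)) (M k)) (k : ℕ) :
    HasStableRank (M k) (r (k + 1)) := by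
  rcases le_total n k with hk | hk
  · exact hasStableRank_of_eq_zero M hr k hk
  · induction hk using Nat.decreasingInduction with
    | self => exact hasStableRank_of_eq_zero M hr n le_rfl
    | of_succ k _ ih =>
      exact HasStableRank.of_matExact M hM k (hex k) ih

/-- The homology at `L (k + 1)` is supported on the ideal of the differential `M (k + 1)`. -/
theorem exists_pow_smul_mem_range (hM : ∀ k, M k * M (k + 1) = 0) (k : ℕ)
    (hf : IsFaithfulIdeal (detIdeal (M k) (r (k + 1)))) (x : _ → R) (hx : M k *ᵥ x = 0) :
    ∃ K, ∀ a ∈ detIdeal (M (k + 1)) (r (k + 1 + 1)) ^ K, ∃ y, M (k + 1) *ᵥ y = a • x := by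
  obtain ⟨K, hK⟩ := exists_detIdeal_pow_le (M (k + 1)) (r (k + 1 + 1))
    ((LinearMap.range (M (k + 1)).mulVecLin).comap (LinearMap.toSpanSingleton R _ x))
    fun ρ γ => by
      have : Module.Flat R (Localization.Away ((M (k + 1)).submatrix ρ γ).det) :=
        IsLocalization.flat _ (Submonoid.powers ((M (k + 1)).submatrix ρ γ).det)
      obtain ⟨y, hy⟩ := matExact_of_isUnit (s := r (k + 1)) (isUnit_det_map_away (M (k + 1)) ρ γ)
        (by simp) ((M k).map (algebraMap R _)) (map_complex M _ hM k)
        (by rw [detIdeal_map]; exact hf.map_of_flat _ (detIdeal_fg _ _)) (algebraMap R _ ∘ x)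
        (by funext i; rw [← RingHom.map_mulVec, hx]; simp)
      obtain ⟨N, z, hz⟩ := exists_pow_smul_eq_mulVec _ _ _ y hy
      exact ⟨N, z, by simpa using hz⟩
  refine ⟨K, fun a ha => ?_⟩
  obtain ⟨y, hy⟩ := hK ha
  exact ⟨y, by simpa using hy⟩

end Complex

/-! ### The acyclicity lemma, by dimension shifting. -/

section Acyclicity

open RingTheory.Sequence

universe u v

variable {R : Type u} [CommRing R]

theorem isWeaklyRegular_of_flat_module (P : Type*) [AddCommGroup P] [Module R P]
    [Module.Flat R P] {fs : List R} (h : IsWeaklyRegular R fs) : IsWeaklyRegular P fs :=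
  ((TensorProduct.rid R P).isWeaklyRegular_congr fs).1 (h.isWeaklyRegular_lTensor (M₂ := P))

/-- If a complex `F` is exact at `F 1, …, F j`, and a sequence of length `j + 1` is weakly regular
on its terms and on the cokernel `N` of `F (j + 1) → F j`, then no nonzero element of the cokernel
of `F 1 → F 0` is annihilated by the sequence. -/
theorem mem_range_of_forall_smul_mem_range (j : ℕ) :
    ∀ (fs : List R) (_ : fs.length = j + 1) (F : ℕ → Type v) [∀ i, AddCommGroup (F i)]
      [∀ i, Module R (F i)] (d : ∀ i, F (i + 1) →ₗ[R] F i) (N : Type v) [AddCommGroup N]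
      [Module R N] (π : F j →ₗ[R] N) (_ : Function.Exact (d j) π) (_ : Function.Surjective π)
      (_ : IsWeaklyRegular N fs) (_ : ∀ i, IsWeaklyRegular (F i) fs)
      (_ : ∀ i x, d i (d (i + 1) x) = 0)
      (_ : ∀ i < j, ∀ x, d i x = 0 → ∃ y, d (i + 1) y = x) (x : F 0)
      (_ : ∀ f ∈ fs, ∃ y, d 0 y = f • x), ∃ y, d 0 y = x := by
  induction j with
  | zero =>
    intro fs hfs F _ _ d N _ _ π hπ _ hN _ _ _ x hx
    obtain ⟨f, rfl⟩ := List.length_eq_one_iff.1 hfs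
    obtain ⟨y, hy⟩ := hx f (by simp)
    refine (hπ x).1 (((isWeaklyRegular_singleton_iff N f).1 hN).right_eq_zero_of_smul ?_)
    rw [← map_smul, ← hy]
    exact (hπ _).2 ⟨y, rfl⟩
  | succ j ih =>
    intro fs hfs F _ _ d N _ _ π hπ hπs hN hF hd hex x hx
    obtain ⟨f, fs, rfl⟩ := List.exists_cons_of_ne_nil (List.ne_nil_of_length_eq_add_one hfs)
    simp only [isWeaklyRegular_cons_iff] at hN hF
    have hmk : ∀ (i : ℕ) (z : F i), (Submodule.Quotient.mk z : QuotSMulTop f (F i)) = 0 ↔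
        ∃ y, f • y = z := by
      intro i z
      rw [Submodule.Quotient.mk_eq_zero, Submodule.mem_smul_pointwise_iff_exists]
      simp
    obtain ⟨z, hz⟩ := hx f (by simp)
    -- With `d 0 z = f • x`, the class of z replaces x in the complex shifted by one and reduced
    -- modulo f, with the shorter sequence.
    have key : ∃ y, QuotSMulTop.map f (d 1) y = Submodule.Quotient.mk z := by
      refine ih fs (by simpa using hfs) (fun i => QuotSMulTop f (F (i + 1)))
        (fun i => QuotSMulTop.map f (d (i + 1))) (QuotSMulTop f N) (QuotSMulTop.map f π)
        (QuotSMulTop.map_exact f hπ hπs) (QuotSMulTop.map_surjective f hπs) hN.2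
        (fun i => (hF (i + 1)).2) ?_ ?_ _ ?_
      · intro i y
        obtain ⟨y, rfl⟩ := Submodule.Quotient.mk_surjective _ y
        simp [hd]
      · intro i hi y hy
        obtain ⟨y, rfl⟩ := Submodule.Quotient.mk_surjective _ y
        rw [QuotSMulTop.map_apply_mk, hmk] at hy
        obtain ⟨a, ha⟩ := hy
        have h1 : d i a = 0 := by
          refine (hF i).1.right_eq_zero_of_smul ?_
          rw [← map_smul, ha, hd]
        obtain ⟨b, hb⟩ := hex i (by omega) a h1
        obtain ⟨c, hc⟩ := hex (i + 1) (by omega) (y - f • b) (by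
          rw [map_sub, map_smul, hb, ha, sub_self])
        refine ⟨Submodule.Quotient.mk c, ?_⟩
        rw [QuotSMulTop.map_apply_mk, hc, Submodule.Quotient.mk_sub, sub_eq_self, hmk]
        exact ⟨b, rfl⟩
      · intro g hg
        obtain ⟨w, hw⟩ := hx g (by simp [hg])
        have h1 : d 0 (g • z - f • w) = 0 := by
          rw [map_sub, map_smul, map_smul, hz, hw, smul_comm, sub_self]
        obtain ⟨c, hc⟩ := hex 0 (by omega) _ h1
        refine ⟨Submodule.Quotient.mk c, ?_⟩
        rw [QuotSMulTop.map_apply_mk, hc, Submodule.Quotient.mk_sub, Submodule.Quotient.mk_smul,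
          sub_eq_self, hmk]
        exact ⟨w, rfl⟩
    obtain ⟨y, hy⟩ := key
    obtain ⟨y, rfl⟩ := Submodule.Quotient.mk_surjective _ y
    rw [QuotSMulTop.map_apply_mk, ← sub_eq_zero, ← Submodule.Quotient.mk_sub, hmk] at hy
    obtain ⟨w, hw⟩ := hy
    -- Modulo the image of `d 1`, which `d 0` kills, z equals `-(f • w)`; regularity of f on `F 0`
    -- then allows cancelling f.
    refine ⟨-w, ?_⟩
    have h1 : f • d 0 (-w) = f • x := by
      rw [← map_smul, smul_neg, hw, neg_sub, map_sub, hd, sub_zero, hz]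
    exact (hF 0).1 h1

end Acyclicity

/-! ### Exactness from weakly regular sequences in the determinantal ideals. -/

section Complex

open RingTheory.Sequence

variable {R : Type*} [CommRing R] {r : ℕ → ℕ}
  (M : ∀ k, Matrix (Fin (r (k + 1) + r k)) (Fin (r (k + 1 + 1) + r (k + 1))) R)

theorem mem_range_of_pow_mul_mem_range {m p : Type*} [Fintype p] (v : Matrix m p R) (I : Ideal R)
    (h : ∀ x, (∀ a ∈ I, ∃ y, v *ᵥ y = a • x) → ∃ y, v *ᵥ y = x) (K : ℕ) (x : m → R)
    (hx : ∀ a ∈ I ^ K, ∃ y, v *ᵥ y = a • x) : ∃ y, v *ᵥ y = x := by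
  induction K generalizing x with
  | zero => simpa using hx 1 (by simp)
  | succ K ih =>
    refine ih x fun b hb => h _ fun a ha => ?_
    rw [smul_smul]
    exact hx _ (by rw [pow_succ']; exact Ideal.mul_mem_mul ha hb)

/-- Elements of the cokernel of `M 1` with support in the ideal of `M j` vanish where `M (j + 1)`
has a unit minor of maximal order. -/
theorem mem_range_of_isUnit_minor (hM : ∀ k, M k * M (k + 1) = 0) (j : ℕ)
    (hex : ∀ k, MatExact (M (k + 1 + 1)) (M (k + 1))) (fs : List R) (hlen : fs.length = j + 2)
    (hreg : IsWeaklyRegular R fs)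
    (ρ : Fin (r (j + 1 + 1 + 1)) → Fin (r (j + 1 + 1 + 1) + r (j + 1 + 1)))
    (γ : Fin (r (j + 1 + 1 + 1)) → Fin (r (j + 1 + 1 + 1 + 1) + r (j + 1 + 1 + 1)))
    (h : IsUnit ((M (j + 1 + 1)).submatrix ρ γ).det)
    (hbot : detIdeal (M (j + 1 + 1)) (r (j + 1 + 1 + 1) + 1) = ⊥)
    (x : Fin (r (1 + 1) + r 1) → R)
    (hx : ∀ f ∈ fs, ∃ y, M 1 *ᵥ y = f • x) : ∃ y, M 1 *ᵥ y = x := by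
  classical
  -- `columnCoproj` identifies the cokernel of `M (j + 1 + 1)` with a free module, on which the
  -- sequence remains weakly regular.
  refine mem_range_of_forall_smul_mem_range (j + 1) fs hlen
    (fun i => Fin (r (i + 1 + 1) + r (i + 1)) → R) (fun i => (M (i + 1)).mulVecLin)
    ({i // i ∉ Set.range ρ} → R) (columnCoproj (M (j + 1 + 1)) ρ γ).mulVecLin ?_ ?_
    (isWeaklyRegular_of_flat_module _ hreg) (fun i => isWeaklyRegular_of_flat_module _ hreg)
    ?_ ?_ x hx
  · intro y
    refine ⟨fun hy => exists_mulVec_of_columnCoproj_mulVec_eq_zero h y hy, ?_⟩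
    rintro ⟨z, rfl⟩
    simp [mulVec_mulVec, columnCoproj_mul h hbot]
  · exact fun y => ⟨_, columnCoproj_mulVec_extend y⟩
  · intro i y
    simp [mulVec_mulVec, hM]
  · exact fun i _ y hy => hex i y hy

/-- A sequence of elements of `I` of length `k`, weakly regular on the ring. -/
def HasWeaklyRegularSeq (I : Ideal R) (k : ℕ) : Prop :=
  ∃ fs : List R, fs.length = k ∧ (∀ f ∈ fs, f ∈ I) ∧ IsWeaklyRegular R fs

theorem HasWeaklyRegularSeq.of_succ {I : Ideal R} {k : ℕ} (h : HasWeaklyRegularSeq I (k + 1)) :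
    HasWeaklyRegularSeq I k := by
  obtain ⟨fs, hlen, hI, hreg⟩ := h
  refine ⟨fs.take k, by simp [hlen], fun f hf => hI f (List.mem_of_mem_take hf), ?_⟩
  rw [← List.take_append_drop k fs, isWeaklyRegular_append_iff] at hreg
  exact hreg.1

theorem HasWeaklyRegularSeq.isFaithfulIdeal {I : Ideal R} {k : ℕ}
    (h : HasWeaklyRegularSeq I (k + 1)) : IsFaithfulIdeal I := by
  obtain ⟨fs, hlen, hI, hreg⟩ := h
  obtain ⟨f, fs, rfl⟩ := List.exists_cons_of_ne_nil (List.ne_nil_of_length_eq_add_one hlen)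
  rw [isWeaklyRegular_cons_iff] at hreg
  exact fun x hx => hreg.1.right_eq_zero_of_smul (hx f (hI f (by simp)))

theorem HasWeaklyRegularSeq.of_eq_top {I : Ideal R} (h : I = ⊤) (k : ℕ) :
    HasWeaklyRegularSeq I k := by
  refine ⟨List.replicate k 1, by simp, by simp [h], ?_⟩
  -- All modules are allowed because the induction passes to a quotient.
  suffices ∀ (N : Type _) [AddCommGroup N] [Module R N], IsWeaklyRegular N (List.replicate k (1 : R))
    from this R
  induction k with
  | zero => exact fun N _ _ => .nil R N
  | succ k ih =>
    intro N _ _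
    rw [List.replicate_succ, isWeaklyRegular_cons_iff]
    exact ⟨fun x y h => by simpa using h, ih _⟩

theorem matExact_zero_of_hasWeaklyRegularSeq {n : ℕ} (hr : ∀ k, n < k → r k = 0)
    (hM : ∀ k, M k * M (k + 1) = 0)
    (hex : ∀ k, MatExact (M (k + 1 + 1)) (M (k + 1)))
    (hgr : ∀ k, HasWeaklyRegularSeq (detIdeal (M k) (r (k + 1))) (k + 1)) :
    MatExact (M 1) (M 0) := by
  intro x hx
  have hI : ∀ j, ∃ K, ∀ a ∈ detIdeal (M (j + 1)) (r (j + 1 + 1)) ^ K,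
      ∃ y, M 1 *ᵥ y = a • x := by
    intro j
    induction j with
    | zero => exact exists_pow_smul_mem_range M hM 0 (hgr 0).isFaithfulIdeal x hx
    | succ j ih =>
      obtain ⟨K, hK⟩ := ih
      obtain ⟨fs, hlen, hfs, hreg⟩ := hgr (j + 1)
      have hbot := detIdeal_succ_eq_bot M hM (j + 1 + 1) (hgr (j + 1 + 1 + 1)).isFaithfulIdeal
      obtain ⟨K', hK'⟩ := exists_detIdeal_pow_le (M (j + 1 + 1)) (r (j + 1 + 1 + 1))
        ((LinearMap.range (M 1).mulVecLin).comap (LinearMap.toSpanSingleton R _ x))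
        fun ρ γ => by
          have : Module.Flat R (Localization.Away ((M (j + 1 + 1)).submatrix ρ γ).det) :=
            IsLocalization.flat _ (Submonoid.powers ((M (j + 1 + 1)).submatrix ρ γ).det)
          let φ := algebraMap R (Localization.Away ((M (j + 1 + 1)).submatrix ρ γ).det)
          obtain ⟨y, hy⟩ : ∃ y, (M 1).map φ *ᵥ y = φ ∘ x := by
            -- A power of the ideal multiplies x into the range; removing one factor at a time
            -- reduces to vectors sent there by the ideal itself, hence by its weakly regular
            -- sequence.
            refine mem_range_of_pow_mul_mem_range _
              ((detIdeal (M (j + 1)) (r (j + 1 + 1))).map φ) (fun z hz => ?_) K _ ?_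
            · refine mem_range_of_isUnit_minor (fun k => (M k).map φ) (map_complex M φ hM) j
                (fun k => (hex k).map_of_flat _ (hM _)) (fs.map φ) (by simp [hlen])
                hreg.of_flat ρ γ (isUnit_det_map_away _ ρ γ)
                (by rw [detIdeal_map, hbot, Ideal.map_bot]) z fun f hf => ?_
              obtain ⟨g, hg, rfl⟩ := List.mem_map.1 hf
              exact hz _ (Ideal.mem_map_of_mem _ (hfs g hg))
            · intro a ha
              rw [← Ideal.map_pow] at ha
              induction ha using Submodule.span_induction with
              | mem a ha =>
                obtain ⟨a, ha, rfl⟩ := ha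
                obtain ⟨y, hy⟩ := hK a ha
                refine ⟨φ ∘ y, funext fun i => ?_⟩
                erw [← RingHom.map_mulVec, hy]
                simp [φ]
              | zero => exact ⟨0, by simp⟩
              | add a b _ _ ha hb =>
                obtain ⟨y, hy⟩ := ha
                obtain ⟨z, hz⟩ := hb
                exact ⟨y + z, by rw [mulVec_add, hy, hz, add_smul]⟩
              | smul c a _ ha =>
                obtain ⟨y, hy⟩ := ha
                exact ⟨c • y, by rw [mulVec_smul, hy, smul_smul, smul_eq_mul]⟩
          obtain ⟨N, z, hz⟩ := exists_pow_smul_eq_mulVec _ _ _ y hy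
          exact ⟨N, z, by simpa using hz⟩
      refine ⟨K', fun a ha => ?_⟩
      obtain ⟨y, hy⟩ := hK' ha
      exact ⟨y, by simpa using hy⟩
  obtain ⟨K, hK⟩ := hI n
  have h1 : detIdeal (M (n + 1)) (r (n + 1 + 1)) = ⊤ := by
    suffices ∀ s, s = 0 → detIdeal (M (n + 1)) s = ⊤ from this _ (hr _ (by omega))
    rintro _ rfl
    exact detIdeal_zero _
  rw [h1, ← Ideal.one_eq_top, one_pow, Ideal.one_eq_top] at hK
  simpa using hK 1 trivial

theorem matExact_of_hasWeaklyRegularSeq (n : ℕ) : ∀ {r : ℕ → ℕ}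
    (M : ∀ k, Matrix (Fin (r (k + 1) + r k)) (Fin (r (k + 1 + 1) + r (k + 1))) R)
    (_ : ∀ k, n < k → r k = 0) (_ : ∀ k, M k * M (k + 1) = 0)
    (_ : ∀ k, HasWeaklyRegularSeq (detIdeal (M k) (r (k + 1))) (k + 1)) (k : ℕ),
    MatExact (M (k + 1)) (M k) := by
  induction n with
  | zero =>
    intro r M hr hM _ k x _
    refine ⟨0, funext fun i => ?_⟩
    have := i.2
    simp only [hr (k + 1) (by omega), hr (k + 1 + 1) (by omega)] at this
    omega
  | succ n ih =>
    intro r M hr hM hgr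
    have h1 : ∀ k, MatExact (M (k + 1 + 1)) (M (k + 1)) :=
      ih (r := fun k => r (k + 1)) (fun k => M (k + 1)) (fun k hk => hr _ (by omega))
        -- Truncation lowers each required length by one, so the sequences are longer than needed.
        (fun k => hM (k + 1)) fun k => (hgr (k + 1)).of_succ
    rintro (_ | k)
    · exact matExact_zero_of_hasWeaklyRegularSeq M hr hM h1 hgr
    · exact h1 k

end Complex

open RingTheory.Sequence

/-! ### Explicit Kronecker sequences and elimination of the first variable. -/

section KroneckerSequence

open scoped Pointwise

variable {A : Type*} [CommRing A]

/-- The polynomial in the single variable `X i` with coefficients `a 0, …, a (m - 1)`. -/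
noncomputable def kroneckerPoly {m : ℕ} (a : Fin m → A) (i : ℕ) : MvPolynomial ℕ A :=
  ∑ j : Fin m, MvPolynomial.monomial (Finsupp.single i (j : ℕ)) (a j)

theorem contentIdeal_kroneckerPoly {m : ℕ} (a : Fin m → A) (i : ℕ) :
    contentIdeal (kroneckerPoly a i) = Ideal.span (Set.range a) := by
  have hc : ∀ d, MvPolynomial.coeff d (kroneckerPoly a i) =
      ∑ j : Fin m, if Finsupp.single i (j : ℕ) = d then a j else 0 := by
    intro d
    simp [kroneckerPoly, MvPolynomial.coeff_sum, MvPolynomial.coeff_monomial]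
  refine le_antisymm (Ideal.span_le.2 ?_) (Ideal.span_le.2 ?_)
  · rintro _ ⟨d, rfl⟩
    dsimp only
    rw [hc]
    refine Ideal.sum_mem _ fun j _ => ?_
    split_ifs
    · exact Ideal.subset_span ⟨j, rfl⟩
    · exact Ideal.zero_mem _
  · rintro _ ⟨j, rfl⟩
    refine Ideal.subset_span ⟨Finsupp.single i (j : ℕ), ?_⟩
    dsimp only
    rw [hc, Finset.sum_eq_single j]
    · simp
    · intro l _ hl
      rw [if_neg]
      exact fun h => hl (Fin.ext (Finsupp.single_injective i h))
    · simp

theorem vars_kroneckerPoly {m : ℕ} (a : Fin m → A) (i : ℕ) :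
    (kroneckerPoly a i).vars ⊆ {i} := by
  classical
  refine (MvPolynomial.vars_sum_subset _ _).trans (Finset.biUnion_subset.2 fun j _ => ?_)
  intro l hl
  by_cases h : a j = 0
  · simp [h] at hl
  · rw [MvPolynomial.vars_monomial h] at hl
    exact Finsupp.support_single_subset hl

theorem isKroneckerSeq_kroneckerPoly {m : ℕ} (a : Fin m → A) (k : ℕ) :
    IsKroneckerSeq (Ideal.span (Set.range a)) fun i : Fin k => kroneckerPoly a i := by
  refine ⟨fun i => contentIdeal_kroneckerPoly a i, fun i j hij => ?_⟩
  refine Finset.disjoint_of_subset_left (vars_kroneckerPoly a i)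
    (Finset.disjoint_of_subset_right (vars_kroneckerPoly a j) ?_)
  simpa [Fin.val_inj] using hij

/-- The univariate polynomial with coefficients `a 0, …, a (m - 1)`. -/
noncomputable def coeffPoly {m : ℕ} (a : Fin m → A) : Polynomial A :=
  ∑ j : Fin m, Polynomial.monomial (j : ℕ) (a j)

theorem coeffPoly_mem_nonZeroDivisors {m : ℕ} (a : Fin m → A)
    (h : IsFaithfulIdeal (Ideal.span (Set.range a))) :
    coeffPoly a ∈ nonZeroDivisors (Polynomial A) := by
  rw [Polynomial.mem_nonZeroDivisors_iff]
  refine fun x hx => h x fun c hc => ?_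
  have hj : ∀ j, a j * x = 0 := by
    intro j
    have h1 := congrArg (fun p => Polynomial.coeff p (j : ℕ)) hx
    simpa [coeffPoly, Polynomial.finsetSum_coeff, Polynomial.coeff_monomial, Fin.val_inj,
      mul_comm x] using h1
  induction hc using Submodule.span_induction with
  | mem c hc => obtain ⟨j, rfl⟩ := hc; exact hj j
  | zero => simp
  | add a b _ _ ha hb => rw [add_mul, ha, hb, add_zero]
  | smul c a _ ha => rw [smul_eq_mul, mul_assoc, ha, mul_zero]

/-- The bijection sending `0` to `none`. -/
def natEquivOption : ℕ ≃ Option ℕ where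
  toFun n := Nat.casesOn n none some
  invFun o := o.elim 0 Nat.succ
  left_inv n := by cases n <;> rfl
  right_inv o := by cases o <;> rfl

variable (A) in
/-- Polynomials in `X 0, X 1, …` as polynomials in `X 1, X 2, …` over `A[X 0]`. -/
noncomputable def splitFirstVariable :
    MvPolynomial ℕ A ≃ₐ[A] MvPolynomial ℕ (Polynomial A) :=
  (MvPolynomial.renameEquiv A natEquivOption).trans (MvPolynomial.optionEquivRight A ℕ)

theorem splitFirstVariable_kroneckerPoly_zero {m : ℕ} (a : Fin m → A) :
    splitFirstVariable A (kroneckerPoly a 0) = MvPolynomial.C (coeffPoly a) := by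
  have h0 : splitFirstVariable A (MvPolynomial.X 0) = MvPolynomial.C Polynomial.X := by
    simp [splitFirstVariable, natEquivOption]
  have hC : ∀ c, splitFirstVariable A (MvPolynomial.C c) =
      MvPolynomial.C (Polynomial.C c) := fun c => by
    simp [splitFirstVariable]
  simp only [kroneckerPoly, coeffPoly, map_sum, MvPolynomial.monomial_eq, map_mul, hC,
    Finsupp.prod_single_index, pow_zero, map_pow, h0, ← Polynomial.C_mul_X_pow_eq_monomial]

theorem splitFirstVariable_kroneckerPoly_succ {m : ℕ} (a : Fin m → A) (i : ℕ) :
    splitFirstVariable A (kroneckerPoly a (i + 1)) = kroneckerPoly (Polynomial.C ∘ a) i := by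
  have h0 : splitFirstVariable A (MvPolynomial.X (i + 1)) = MvPolynomial.X i := by
    simp [splitFirstVariable, natEquivOption]
  have hC : ∀ c, splitFirstVariable A (MvPolynomial.C c) =
      MvPolynomial.C (Polynomial.C c) := fun c => by
    simp [splitFirstVariable]
  simp only [kroneckerPoly, map_sum, MvPolynomial.monomial_eq, map_mul, hC,
    Finsupp.prod_single_index, pow_zero, map_pow, h0, Function.comp_apply]

theorem map_kroneckerPoly {B : Type*} [CommRing B] (φ : A →+* B) {m : ℕ} (a : Fin m → A) (i : ℕ) :
    MvPolynomial.map φ (kroneckerPoly a i) = kroneckerPoly (φ ∘ a) i := by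
  simp [kroneckerPoly, MvPolynomial.map_monomial]

theorem isWeaklyRegular_cons_of_surjective {B B' : Type*} [CommRing B] [CommRing B']
    (φ : B →+* B') (hφ : Function.Surjective φ) (f : B) (hker : RingHom.ker φ = Ideal.span {f})
    (hf : IsSMulRegular B f) (fs : List B) (h : IsWeaklyRegular B' (fs.map φ)) :
    IsWeaklyRegular B (f :: fs) := by
  let _ := φ.toAlgebra
  refine .cons hf ?_
  have h1 : IsWeaklyRegular B' fs := (isWeaklyRegular_map_algebraMap_iff B' B' fs).1 h
  have hk : f • (⊤ : Submodule B B) = LinearMap.ker (Algebra.linearMap B B') := by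
    ext x
    have h2 : x ∈ LinearMap.ker (Algebra.linearMap B B') ↔ x ∈ RingHom.ker φ := Iff.rfl
    rw [h2, hker, Ideal.mem_span_singleton', Submodule.mem_smul_pointwise_iff_exists]
    simp [mul_comm]
  exact (((Submodule.quotEquivOfEq _ _ hk).trans
    ((Algebra.linearMap B B').quotKerEquivOfSurjective hφ)).isWeaklyRegular_congr fs).2 h1

/-- A[X_0, X_1, …] modulo the first term is (A[X_0]/f)[X_1, …], with f = `coeffPoly a`, and the
remaining terms become a Kronecker sequence over the new base. Faithfulness makes the first term
regular by McCoy. -/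
theorem isWeaklyRegular_kroneckerPoly_succ {m : ℕ} (a : Fin m → A) (k : ℕ)
    (ha : IsFaithfulIdeal (Ideal.span (Set.range a)))
    (h : IsWeaklyRegular (MvPolynomial ℕ (Polynomial A ⧸ Ideal.span {coeffPoly a}))
      (List.ofFn fun i : Fin k =>
        kroneckerPoly (Ideal.Quotient.mk (Ideal.span {coeffPoly a}) ∘ Polynomial.C ∘ a) i)) :
    IsWeaklyRegular (MvPolynomial ℕ A)
      (List.ofFn fun i : Fin (k + 1) => kroneckerPoly a i) := by
  let π := Ideal.Quotient.mk (Ideal.span {coeffPoly a})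
  let φ : MvPolynomial ℕ A →+* MvPolynomial ℕ (Polynomial A ⧸ Ideal.span {coeffPoly a}) :=
    (MvPolynomial.map π).comp (splitFirstVariable A : _ →+* _)
  have hφ : ∀ p, φ p = MvPolynomial.map π (splitFirstVariable A p) := fun _ => rfl
  rw [List.ofFn_succ]
  have hsurj : Function.Surjective φ :=
    (MvPolynomial.map_surjective π Ideal.Quotient.mk_surjective).comp
      (splitFirstVariable A).surjective
  refine isWeaklyRegular_cons_of_surjective (B := MvPolynomial ℕ A)
    (B' := MvPolynomial ℕ (Polynomial A ⧸ Ideal.span {coeffPoly a})) φ hsurj _ ?_ ?_ _ ?_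
  · ext p
    rw [RingHom.mem_ker, hφ, ← RingHom.mem_ker, MvPolynomial.ker_map, Ideal.mk_ker, Ideal.map_span,
      Set.image_singleton, Ideal.mem_span_singleton, Ideal.mem_span_singleton,
      ← splitFirstVariable_kroneckerPoly_zero, Fin.val_zero]
    exact map_dvd_iff (splitFirstVariable A)
  · have h1 := coeffPoly_mem_nonZeroDivisors a ha
    refine IsSMulRegular.of_right_eq_zero_of_smul fun p hp => ?_
    rw [← (splitFirstVariable A).map_eq_zero_iff]
    have h2 := congrArg (splitFirstVariable A) hp
    rw [smul_eq_mul, map_mul, Fin.val_zero, splitFirstVariable_kroneckerPoly_zero, map_zero] at h2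
    ext1 d
    have h3 := congrArg (MvPolynomial.coeff d) h2
    rw [MvPolynomial.coeff_C_mul, MvPolynomial.coeff_zero, mul_comm] at h3
    exact (mem_nonZeroDivisors_iff_right.1 h1) _ h3
  · rw [List.map_ofFn]
    have h1 : (φ ∘ fun i : Fin k => kroneckerPoly a i.succ) =
        fun i : Fin k => kroneckerPoly (π ∘ Polynomial.C ∘ a) i := by
      funext i
      rw [Function.comp_apply, Fin.val_succ, hφ, splitFirstVariable_kroneckerPoly_succ,
        map_kroneckerPoly]
    rw [h1]
    exact h

end KroneckerSequence

/-! ### The two implications between exactness and true grade. -/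

section Complex

/-- Modulo a regular element, an exact complex stays exact except at the last place. -/
theorem matExact_map_of_ker_eq_span {R S : Type*} [CommRing R] [CommRing S] (φ : R →+* S)
    (hφ : Function.Surjective φ) (f : R) (hf : f ∈ nonZeroDivisors R)
    (hker : RingHom.ker φ = Ideal.span {f}) {m n p q : Type*} [Fintype m] [Fintype n] [Fintype p]
    {M₀ : Matrix q m R} {M₁ : Matrix m n R} {M₂ : Matrix n p R} (h0 : M₀ * M₁ = 0)
    (h1 : MatExact M₁ M₀) (h2 : MatExact M₂ M₁) : MatExact (M₂.map φ) (M₁.map φ) := by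
  intro x' hx
  choose x hx' using fun i => hφ (x' i)
  obtain rfl : φ ∘ x = x' := funext hx'
  have h3 : ∀ i, ∃ c, f * c = (M₁ *ᵥ x) i := by
    intro i
    have : (M₁ *ᵥ x) i ∈ RingHom.ker φ := by
      rw [RingHom.mem_ker, RingHom.map_mulVec, hx, Pi.zero_apply]
    rw [hker, Ideal.mem_span_singleton'] at this
    obtain ⟨c, hc⟩ := this
    exact ⟨c, by rw [mul_comm, hc]⟩
  choose c hc using h3
  have hc' : f • c = M₁ *ᵥ x := funext hc
  -- Lifting x gives `M₁ *ᵥ x = f • c`; since f is regular, c is a cycle, hence a boundary `M₁ *ᵥ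
  -- d`, and `x - f • d` is a true cycle lifting the same class.
  have h4 : M₀ *ᵥ c = 0 := by
    have : f • (M₀ *ᵥ c) = 0 := by
      rw [← mulVec_smul, hc', mulVec_mulVec, h0, zero_mulVec]
    funext i
    refine (mem_nonZeroDivisors_iff_right.1 hf) _ ?_
    rw [mul_comm]
    exact congrFun this i
  obtain ⟨d, hd⟩ := h1 c h4
  obtain ⟨y, hy⟩ := h2 (x - f • d) (by rw [mulVec_sub, mulVec_smul, hd, hc', sub_self])
  refine ⟨φ ∘ y, funext fun i => ?_⟩
  have hf0 : φ f = 0 := by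
    rw [← RingHom.mem_ker, hker]
    exact Ideal.mem_span_singleton_self f
  rw [← RingHom.map_mulVec, hy]
  simp [hf0]

universe u

theorem isWeaklyRegular_kroneckerPoly_of_exact (k : ℕ) : ∀ {A : Type u} [CommRing A] {n : ℕ}
    {r : ℕ → ℕ} (M : ∀ k, Matrix (Fin (r (k + 1) + r k)) (Fin (r (k + 1 + 1) + r (k + 1))) A)
    (_ : ∀ k, n < k → r k = 0) (_ : ∀ k, M k * M (k + 1) = 0)
    (_ : ∀ k, MatExact (M (k + 1)) (M k)) {m : ℕ} (a : Fin m → A)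
    (_ : Ideal.span (Set.range a) = detIdeal (M k) (r (k + 1))),
    IsWeaklyRegular (MvPolynomial ℕ A)
      (List.ofFn fun i : Fin (k + 1) => kroneckerPoly a i) := by
  induction k with
  | zero =>
    intro A _ n r M hr hM hex m a ha
    refine isWeaklyRegular_kroneckerPoly_succ a 0 ?_ (by simp)
    rw [ha]
    exact (hasStableRank_of_exact M hr hM hex 0).1
  | succ k ih =>
    intro A _ n r M hr hM hex m a ha
    have hfaith : IsFaithfulIdeal (Ideal.span (Set.range a)) := by
      rw [ha]
      exact (hasStableRank_of_exact M hr hM hex (k + 1)).1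
    refine isWeaklyRegular_kroneckerPoly_succ a (k + 1) hfaith ?_
    let π := Ideal.Quotient.mk (Ideal.span {coeffPoly a})
    let M' := fun k => (M k).map (algebraMap A (Polynomial A))
    have hM' : ∀ k, M' k * M' (k + 1) = 0 := map_complex M _ hM
    have hex' : ∀ k, MatExact (M' (k + 1)) (M' k) := fun k => (hex k).map_of_flat _ (hM k)
    -- Dropping the last map lowers the index of the same determinantal ideal by one, matching the
    -- one term of the sequence already used.
    refine ih (n := n) (r := fun k => r (k + 1)) (fun k => (M' (k + 1)).map π)
      (fun k hk => hr _ (by omega)) (fun k => map_complex M' π hM' (k + 1)) (fun k => ?_) _ ?_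
    · exact matExact_map_of_ker_eq_span π Ideal.Quotient.mk_surjective (coeffPoly a)
        (coeffPoly_mem_nonZeroDivisors a hfaith) Ideal.mk_ker (hM' k) (hex' k) (hex' (k + 1))
    · rw [detIdeal_map, detIdeal_map, ← ha, Ideal.map_map, Ideal.map_span, ← Set.range_comp]
      rfl

theorem trueGradeGE_of_exact {A : Type*} [CommRing A] {n : ℕ} {r : ℕ → ℕ}
    (M : ∀ k, Matrix (Fin (r (k + 1) + r k)) (Fin (r (k + 1 + 1) + r (k + 1))) A)
    (hr : ∀ k, n < k → r k = 0) (hM : ∀ k, M k * M (k + 1) = 0)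
    (hex : ∀ k, MatExact (M (k + 1)) (M k)) (k : ℕ) :
    TrueGradeGE (detIdeal (M k) (r (k + 1))) (k + 1) := by
  obtain ⟨m, a, ha⟩ := Submodule.fg_iff_exists_fin_generating_family.1
    (detIdeal_fg (M k) (r (k + 1)))
  refine ⟨fun i => kroneckerPoly a i, ?_, isWeaklyRegular_kroneckerPoly_of_exact k M hr hM hex a ha⟩
  rw [← ha]
  exact isKroneckerSeq_kroneckerPoly a (k + 1)

theorem mem_map_C_contentIdeal {A : Type*} [CommRing A] (f : MvPolynomial ℕ A) :
    f ∈ (contentIdeal f).map (MvPolynomial.C : A →+* MvPolynomial ℕ A) :=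
  MvPolynomial.mem_map_C_iff.2 fun d => Ideal.subset_span ⟨d, rfl⟩

theorem TrueGradeGE.hasWeaklyRegularSeq {A : Type*} [CommRing A] {I : Ideal A} {k : ℕ}
    (h : TrueGradeGE I k) :
    HasWeaklyRegularSeq (I.map (MvPolynomial.C : A →+* MvPolynomial ℕ A)) k := by
  obtain ⟨f, ⟨hc, -⟩, hreg⟩ := h
  refine ⟨List.ofFn f, by simp, fun g hg => ?_, hreg⟩
  obtain ⟨i, rfl⟩ := (List.mem_ofFn' _ _).1 hg
  rw [← hc i]
  exact mem_map_C_contentIdeal _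

/-- A preimage found over S is carried back to R by the retraction. -/
theorem matExact_of_map_of_leftInverse {R S : Type*} [CommRing R] [CommRing S] (φ : R →+* S)
    (ψ : S →+* R) (hψ : Function.LeftInverse ψ φ) {m p q : Type*} [Fintype m] [Fintype p]
    {N : Matrix m p R} {M : Matrix q m R} (h : MatExact (N.map φ) (M.map φ)) : MatExact N M := by
  intro x hx
  obtain ⟨y, hy⟩ := h (φ ∘ x) (by funext i; rw [← RingHom.map_mulVec, hx]; simp)
  refine ⟨ψ ∘ y, funext fun i => ?_⟩
  have h1 : (N.map φ).map ψ = N := by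
    ext i j
    exact hψ _
  rw [← hψ (x i), ← Function.comp_apply (f := φ), ← hy, RingHom.map_mulVec, h1]

theorem matExact_of_trueGradeGE {A : Type*} [CommRing A] {n : ℕ} {r : ℕ → ℕ}
    (M : ∀ k, Matrix (Fin (r (k + 1) + r k)) (Fin (r (k + 1 + 1) + r (k + 1))) A)
    (hr : ∀ k, n < k → r k = 0) (hM : ∀ k, M k * M (k + 1) = 0)
    (hgr : ∀ k < n, TrueGradeGE (detIdeal (M k) (r (k + 1))) (k + 1)) (k : ℕ) :
    MatExact (M (k + 1)) (M k) := by
  refine matExact_of_map_of_leftInverse (MvPolynomial.C : A →+* MvPolynomial ℕ A)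
    MvPolynomial.constantCoeff (fun a => MvPolynomial.constantCoeff_C _ a) ?_
  refine matExact_of_hasWeaklyRegularSeq n (fun k => (M k).map MvPolynomial.C) hr
    (map_complex M _ hM) (fun k => ?_) k
  rw [detIdeal_map]
  rcases lt_or_ge k n with hk | hk
  · exact (hgr k hk).hasWeaklyRegularSeq
  · refine .of_eq_top ?_ _
    suffices ∀ s, s = 0 → detIdeal (M k) s = ⊤ by rw [this _ (hr _ (by omega)), Ideal.map_top]
    rintro _ rfl
    exact detIdeal_zero _

end Complex

end FreeComplexExactness

/-! ### Translation from linear maps to matrices. -/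

theorem mainTheorem2 {A : Type*} [CommRing A] (n : ℕ) (r : ℕ → ℕ) (hr : ∀ k, n < k → r k = 0)
    (L : ℕ → Type*) [∀ k, AddCommGroup (L k)] [∀ k, Module A (L k)]
    (b : ∀ k, Module.Basis (Fin (r (k + 1) + r k)) A (L k))
    (u : ∀ k, L (k + 1) →ₗ[A] L k) (hu : ∀ k, u k ∘ₗ u (k + 1) = 0) :
    ((∀ k < n, Function.Exact (u (k + 1)) (u k)) ↔
      ∀ k < n, FreeComplexExactness.TrueGradeGE (FreeComplexExactness.detIdeal
        (LinearMap.toMatrix (b (k + 1)) (b k) (u k)) (r (k + 1))) (k + 1)) ∧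
    ((∀ k < n, Function.Exact (u (k + 1)) (u k)) →
      ∀ k < n, FreeComplexExactness.HasStableRank
        (LinearMap.toMatrix (b (k + 1)) (b k) (u k)) (r (k + 1))) := by
  let M := fun k => LinearMap.toMatrix (b (k + 1)) (b k) (u k)
  have hM : ∀ k, M k * M (k + 1) = 0 := fun k => by
    simp only [M]
    rw [← LinearMap.toMatrix_comp, hu, map_zero]
  have hrepr : ∀ k (x : L (k + 1)), M k *ᵥ (b (k + 1)).equivFun x = (b k).equivFun (u k x) :=
    fun k x => LinearMap.toMatrix_mulVec_repr _ _ _ _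
  have hexact : ∀ k, Function.Exact (u (k + 1)) (u k) ↔
      FreeComplexExactness.MatExact (M (k + 1)) (M k) := by
    intro k
    constructor
    · intro h x hx
      obtain ⟨x, rfl⟩ := (b (k + 1)).equivFun.surjective x
      rw [hrepr, LinearEquiv.map_eq_zero_iff] at hx
      obtain ⟨y, rfl⟩ := (h x).1 hx
      exact ⟨_, hrepr _ y⟩
    · intro h x
      constructor
      · intro hx
        obtain ⟨y, hy⟩ := h ((b (k + 1)).equivFun x) (by rw [hrepr, hx, map_zero])
        obtain ⟨y, rfl⟩ := (b (k + 1 + 1)).equivFun.surjective y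
        rw [hrepr] at hy
        exact ⟨y, (b (k + 1)).equivFun.injective hy⟩
      · rintro ⟨y, rfl⟩
        exact LinearMap.congr_fun (hu k) y
  -- From k = n on, `L (k + 1)` has rank zero, so exactness there is automatic.
  have hall : (∀ k < n, Function.Exact (u (k + 1)) (u k)) →
      ∀ k, FreeComplexExactness.MatExact (M (k + 1)) (M k) := by
    intro h k
    rcases lt_or_ge k n with hk | hk
    · exact (hexact k).1 (h k hk)
    · intro x _
      refine ⟨0, funext fun i => ?_⟩
      have := i.2
      simp only [hr (k + 1) (by omega), hr (k + 1 + 1) (by omega)] at this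
      omega
  refine ⟨⟨fun h k _ => ?_, fun h k _ => ?_⟩, fun h k _ => ?_⟩
  · exact FreeComplexExactness.trueGradeGE_of_exact M hr hM (hall h) k
  · exact (hexact k).2 (FreeComplexExactness.matExact_of_trueGradeGE M hr hM h k)
  · exact FreeComplexExactness.hasStableRank_of_exact M hr hM (hall h) k
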